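/- **Theorem (Optimal DP-tails fair prediction).** Let $X$ be a random vector in $\mathbb R^d$ and $S$ a random variable in a finite set $\mathcal S$ with $p_s:=\mathbb P(S=s)>0$ for every $s\in\mathcal S$, and let $f^*:\mathbb R^d\times\mathcal S\to\mathbb R$ be measurable (in the regression model $Y=f^*(X,S)+\varepsilon$ it is the Bayes regressor). For a measurable $g:\mathbb R^d\times\mathcal S\to\mathbb R$ let $\nu_{g|s}$ be the conditional law of $g(X,S)$ given $S=s$, with distribution function $F_{g|s}$ and quantile function $Q_{g|s}(t)=\inf\{y\in\mathbb R:F_{g|s}(y)\ge t\}$ for $t\in(0,1]$, $Q_{g|s}(0)=Q_{g|s}(0+)$, with values in $[-\infty,+\infty]$. Assume that every $\nu_{f^*|s}$ has a finite second moment and a density with respect to Lebesgue measure. Let $\alpha\in\mathbb R$ and $p\in[0,1]$. Let $\mathcal F^p_\alpha$ be the set of measurable $g$ such that $F_{g|s}(t)=F_{g|s'}(t)$ for all $s,s'\in\mathcal S$ and $t\ge\alpha$, and $F_{g|s}(\alpha)=p$ for all $s\in\mathcal S$. Put $\mathcal E(g)=\mathbb E[(f^*(X,S)-g(X,S))^2]\in[0,\infty]$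 and consider the problem $(\mathcal P)$: minimize $\mathcal E(g)$ over $g\in\mathcal F^p_\alpha$. Let $\mathcal M^p_\alpha$ be the set of families $(\nu^++\nu^-_s)_{s\in\mathcal S}$ of probability measures on $\mathbb R$, where $\nu^+$ is a positive measure carried by $(\alpha,\infty)$ and each $\nu^-_s$ is a positive measure carried by $(-\infty,\alpha]$ of mass $p$. Let $\mathcal W_2$ be the $2$-Wasserstein distance, let $\bar Q(t)=\sum_{s}p_sQ_{f^*|s}(t)$, and for $\xi\geq0$ let $$Q^\xi_s(t)=\min\{\alpha,Q_{f^*|s}(t)\}\ \text{ for } t\in[0,p],\qquad Q^\xi_s(t)=\max\{\alpha+\xi,\bar Q(t)\}\ \text{ for } t\in(p,1],$$ $$g^{*,\xi}_{\alpha,p}(x,s)=Q^\xi_s\circ F_{f^*|s}\circ f^*(x,s),\qquad g^*_{\alpha,p}=g^{*,0}_{\alpha,p}$$ (these regressors are finite outside a null event for $(X,S)$; infinite values are replaced by $0$). Then: 1. $\inf_{g\in\mathcal F^p_\alpha}\mathcal E(g)=\mathcal E(g^*_{\alpha,p})<\infty$. 2. $\inf_{(\nu_s)\in\mathcal M^p_\alpha}\sum_s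 p_s\mathcal W_2^2(\nu_{f^*|s},\nu_s)=\sum_s p_s\mathcal W_2^2(\nu_{f^*|s},\nu_{g^*_{\alpha,p}|s})$. 3. If $\alpha\le\bar Q(p)$, then $g^*_{\alpha,p}\in\mathcal F^p_\alpha$ and $(\nu_{g^*_{\alpha,p}|s})_s\in\mathcal M^p_\alpha$; hence $g^*_{\alpha,p}$ is a minimizer of $(\mathcal P)$. 4. If $\alpha>\bar Q(p)$, $p<1$ and $\bar Q$ is right-continuous at $p$, then $g^*_{\alpha,p}\notin\mathcal F^p_\alpha$ and $(\mathcal P)$ has no minimizer. 5. In all cases, the following are equivalent: $g^*_{\alpha,p}\in\mathcal F^p_\alpha$; $(\mathcal P)$ has a minimizer; $\alpha\le\bar Q(t)$ for every $t\in(p,1]$. 6. For every $\xi>0$, $g^{*,\xi}_{\alpha,p}\in\mathcal F^p_\alpha$ and $\mathcal E(g^{*,\xi}_{\alpha,p})<\infty$, and $|\mathcal E(g^{*,\xi}_{\alpha,p})-\mathcal E(g^*_{\alpha,p})|=O(\xi)$ as $\xi\to0^+$. -/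

import Mathlib

open MeasureTheory ProbabilityTheory Filter Topology Asymptotics
open scoped ENNReal

noncomputable section

namespace DPTails

/-- The cumulative distribution function `F_ν(y) = ν((-∞, y])` of a law `ν` on `ℝ`. -/
def lawCDF (ν : Measure ℝ) (y : ℝ) : ℝ := ν.real (Set.Iic y)

/-- `inf {y ∈ ℝ : F_ν(y) ≥ t}`, as an extended real number. -/
def genInv (ν : Measure ℝ) (t : ℝ) : EReal :=
  sInf ((fun y : ℝ => (y : EReal)) '' {y : ℝ | t ≤ lawCDF ν y})

/-- The quantile function of `ν` on `[0, 1]`: the generalised inverse of the distribution function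
on `(0, 1]`, and its right limit `Q_ν(0+)` at `0`. It is finite on `(0, 1)`, can be `-∞` at `0`
and can be `+∞` at `1`. -/
def quantile (ν : Measure ℝ) (t : ℝ) : EReal :=
  if t = 0 then ⨅ u ∈ Set.Ioc (0 : ℝ) 1, genInv ν u else genInv ν t

/-- The squared `2`-Wasserstein distance between two laws on `ℝ`, with values in `[0, ∞]`. -/
def wasserstein2Sq (μ ν : Measure ℝ) : ℝ≥0∞ :=
  ⨅ π ∈ {π : Measure (ℝ × ℝ) | π.map Prod.fst = μ ∧ π.map Prod.snd = ν},
    ∫⁻ z, ENNReal.ofReal ((z.1 - z.2) ^ 2) ∂π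

variable {Ω 𝒳 𝒮 : Type*} [MeasurableSpace Ω] [MeasurableSpace 𝒳]

/-- `ν_{g|s}`: the conditional law of `g(X, S)` given `S = s`. -/
def condLaw (P : Measure Ω) (X : Ω → 𝒳) (S : Ω → 𝒮) (g : 𝒳 × 𝒮 → ℝ) (s : 𝒮) : Measure ℝ :=
  (ProbabilityTheory.cond P (S ⁻¹' {s})).map (fun ω => g (X ω, S ω))

/-- Each `ν_{f|s}` has a finite second moment and a density with respect to Lebesgue measure. -/
def DensityAssumption (P : Measure Ω) (X : Ω → 𝒳) (S : Ω → 𝒮) (f : 𝒳 × 𝒮 → ℝ) : Prop :=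
  ∀ s : 𝒮, MemLp (fun y : ℝ => y) 2 (condLaw P X S f s) ∧
    ∃ ρ : ℝ → ℝ≥0∞, Measurable ρ ∧ condLaw P X S f s = volume.withDensity ρ

/-- The class of `(α, p)`-DP-tails fair regressors. -/
def fairClass [MeasurableSpace 𝒮] (P : Measure Ω) (X : Ω → 𝒳) (S : Ω → 𝒮) (α p : ℝ) :
    Set (𝒳 × 𝒮 → ℝ) :=
  {g | Measurable g ∧
    (∀ s s' : 𝒮, ∀ t : ℝ, α ≤ t →
      lawCDF (condLaw P X S g s) t = lawCDF (condLaw P X S g s') t) ∧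
    ∀ s : 𝒮, lawCDF (condLaw P X S g s) α = p}

/-- The objective `𝓔(g) = 𝔼[(f(X, S) - g(X, S))²]`, with values in `[0, ∞]`. -/
def excessRisk (P : Measure Ω) (X : Ω → 𝒳) (S : Ω → 𝒮) (f g : 𝒳 × 𝒮 → ℝ) : ℝ≥0∞ :=
  ∫⁻ ω, ENNReal.ofReal ((f (X ω, S ω) - g (X ω, S ω)) ^ 2) ∂P

/-- `g` is a minimizer of the excess risk over the class of fair regressors. -/
def IsFairMinimizer [MeasurableSpace 𝒮] (P : Measure Ω) (X : Ω → 𝒳) (S : Ω → 𝒮)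
    (f : 𝒳 × 𝒮 → ℝ) (α p : ℝ) (g : 𝒳 × 𝒮 → ℝ) : Prop :=
  g ∈ fairClass P X S α p ∧ ∀ h ∈ fairClass P X S α p, excessRisk P X S f g ≤ excessRisk P X S f h

/-- The families of laws `(ν⁺ + ν⁻_s)_s`, with `ν⁺` carried by `(α, ∞)` and common to all groups,
and `ν⁻_s` carried by `(-∞, α]` and of mass `p`. -/
def measureClass (𝒮 : Type*) (α p : ℝ) : Set (𝒮 → Measure ℝ) :=
  {ν | ∃ (νp : Measure ℝ) (νm : 𝒮 → Measure ℝ),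
    νp (Set.Iic α) = 0 ∧
    (∀ s, νm s (Set.Ioi α) = 0) ∧
    (∀ s, νp Set.univ + νm s Set.univ = 1 ∧ νm s Set.univ = ENNReal.ofReal p) ∧
    ∀ s, ν s = νp + νm s}

variable [Fintype 𝒮]

/-- The barycenter objective `∑ₛ pₛ W₂²(ν_{f|s}, ν_s)`, where `pₛ = P(S = s)`. -/
def barycenterCost (P : Measure Ω) (X : Ω → 𝒳) (S : Ω → 𝒮) (f : 𝒳 × 𝒮 → ℝ)
    (ν : 𝒮 → Measure ℝ) : ℝ≥0∞ :=
  ∑ s, P (S ⁻¹' {s}) * wasserstein2Sq (condLaw P X S f s) (ν s)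

/-- The averaged quantile function `∑ₛ pₛ Q_{f|s}(t)`, where `pₛ = P(S = s)`. -/
def avgQuantile (P : Measure Ω) (X : Ω → 𝒳) (S : Ω → 𝒮) (f : 𝒳 × 𝒮 → ℝ) (t : ℝ) : EReal :=
  ∑ s, ((P.real (S ⁻¹' {s}) : ℝ) : EReal) * quantile (condLaw P X S f s) t

/-- The function equal to `min {α, Q_{f|s}(t)}` for `t ≤ p` and to
`max {β, ∑ₛ pₛ Q_{f|s}(t)}` for `t > p`. The optimal quantile functions `Q*_s` are the case `β = α`
and their perturbations `Q^ξ_s` the case `β = α + ξ`. -/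
def clippedQuantile (P : Measure Ω) (X : Ω → 𝒳) (S : Ω → 𝒮) (f : 𝒳 × 𝒮 → ℝ) (α β p : ℝ)
    (s : 𝒮) (t : ℝ) : EReal :=
  if t ≤ p then min (α : EReal) (quantile (condLaw P X S f s) t)
  else max (β : EReal) (avgQuantile P X S f t)

/-- The regressor `(x, s) ↦ Q_s(F_{f|s}(f(x, s)))`, where `Q_s` is the clipped quantile function.
Infinite values of `Q_s`, possible only where `F_{f|s}(f(x, s))` is `0` or `1`, are replaced
by `0`. -/
def clippedPredictor (P : Measure Ω) (X : Ω → 𝒳) (S : Ω → 𝒮) (f : 𝒳 × 𝒮 → ℝ) (α β p : ℝ) :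
    𝒳 × 𝒮 → ℝ :=
  fun z => (clippedQuantile P X S f α β p z.2 (lawCDF (condLaw P X S f z.2) (f z))).toReal

/-- The regressor `g*_{α,p} = Q*_s ∘ F_{f|s} ∘ f`. -/
def optPredictor (P : Measure Ω) (X : Ω → 𝒳) (S : Ω → 𝒮) (f : 𝒳 × 𝒮 → ℝ) (α p : ℝ) :
    𝒳 × 𝒮 → ℝ :=
  clippedPredictor P X S f α α p

/-- The regressor `g^{*,ξ}_{α,p} = Q^ξ_s ∘ F_{f|s} ∘ f`. -/
def xiPredictor (P : Measure Ω) (X : Ω → 𝒳) (S : Ω → 𝒮) (f : 𝒳 × 𝒮 → ℝ) (α p ξ : ℝ) :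
    𝒳 × 𝒮 → ℝ :=
  clippedPredictor P X S f α (α + ξ) p

end DPTails

end

/-! Everything reduces to quantile functions on `(0, 1)`. Since `ν_{f|s}` has no atoms,
`F_{f|s}(f(X, S))` is uniform given `S = s`, so the regressor `T_s ∘ F_{f|s} ∘ f` has conditional
laws `unif.map (T s)` and risk `∑ₛ pₛ ∫ (Q_{f|s} - T_s)²` (`condLaw_transportPredictor`,
`excessRisk_transportPredictor`). Conversely, the conditional joint law of `(f, g)` is a coupling,
and monotone couplings are optimal on the line (`wasserstein2Sq_map_unif`), so every `g` costs at
least the same expression evaluated at its own conditional quantile functions.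

On quantile functions the constraints read: `T_s(u) ≤ α` for `u ≤ p`, and one common value above `α`
for `u > p`. The minimization is then pointwise in `u`. For `u ≤ p` each `Q_{f|s}(u)` is projected
onto `(-∞, α]`; for `u > p` the variance decomposition shows that only the distance from the common
value to the weighted mean matters, so the mean is projected onto `[α, ∞)`. The resulting cost `J`
bounds both problems from below.

The constraint `T_s(u) > α` is open, so `J` need not be attained. Raising the floor to `α + ξ`
restores feasibility and costs `O(ξ)`, hence `J` is the infimum. If the mean quantile is below `α`
somewhere after `p`, it is so on an interval starting at `p`, where every admissible `T` pays
strictly more than the projection, so there is no minimizer. If it is at least `α` after `p`, strict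
monotonicity makes it exceed `α` there, and the projection is admissible. -/

noncomputable section

namespace DPTails

/-- The uniform law on `(0, 1)`. -/
def unif : Measure ℝ := volume.restrict (Set.Ioo 0 1)

instance : IsProbabilityMeasure unif :=
  ⟨by simp [unif]⟩

lemma ae_unif_mem : ∀ᵐ u ∂unif, u ∈ Set.Ioo (0 : ℝ) 1 :=
  ae_restrict_mem measurableSet_Ioo

lemma unif_Iic {t : ℝ} (ht : t ∈ Set.Icc (0 : ℝ) 1) : unif (Set.Iic t) = ENNReal.ofReal t := by
  rw [unif, Measure.restrict_apply measurableSet_Iic]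
  rcases eq_or_lt_of_le ht.2 with h | h
  · subst h
    rw [Set.inter_eq_right.2 (fun x hx => hx.2.le)]
    simp
  · have : Set.Iic t ∩ Set.Ioo 0 1 = Set.Ioc 0 t := by
      ext x; simp only [Set.mem_inter_iff, Set.mem_Iic, Set.mem_Ioo, Set.mem_Ioc]
      constructor
      · rintro ⟨h1, h2, -⟩; exact ⟨h2, h1⟩
      · rintro ⟨h1, h2⟩; exact ⟨h2, h1, h2.trans_lt h⟩
    rw [this]; simp

lemma unif_Iio_le (t : ℝ) : unif (Set.Iio t) ≤ ENNReal.ofReal t := by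
  rw [unif, Measure.restrict_apply measurableSet_Iio]
  calc volume (Set.Iio t ∩ Set.Ioo 0 1) ≤ volume (Set.Ioo 0 t) :=
        measure_mono fun x hx => ⟨hx.2.1, hx.1⟩
    _ = ENNReal.ofReal t := by simp

/-! ### Quantile functions -/

section Quantile

variable {ν : Measure ℝ}

lemma lawCDF_mono [IsFiniteMeasure ν] : Monotone (lawCDF ν) := fun _ _ h =>
  measureReal_mono (Set.Iic_subset_Iic.2 h)

lemma lawCDF_nonneg (y : ℝ) : 0 ≤ lawCDF ν y := measureReal_nonneg

lemma lawCDF_le_one [IsProbabilityMeasure ν] (y : ℝ) : lawCDF ν y ≤ 1 := measureReal_le_one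

lemma lawCDF_eq_cdf [IsProbabilityMeasure ν] (y : ℝ) : lawCDF ν y = cdf ν y :=
  (cdf_eq_real ν y).symm

lemma genInv_mono : Monotone (genInv ν) := fun _ _ h =>
  sInf_le_sInf (Set.image_mono fun _ hy => h.trans hy)

lemma genInv_of_nonpos {t : ℝ} (ht : t ≤ 0) : genInv ν t = ⊥ := by
  refine EReal.eq_bot_iff_forall_lt _ |>.2 fun y => ?_
  refine lt_of_le_of_lt (sInf_le ⟨y - 1, ht.trans (lawCDF_nonneg _), rfl⟩) ?_
  exact EReal.coe_lt_coe_iff.2 (sub_one_lt y)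

lemma genInv_of_one_lt [IsProbabilityMeasure ν] {t : ℝ} (ht : 1 < t) : genInv ν t = ⊤ := by
  have : {y : ℝ | t ≤ lawCDF ν y} = ∅ := by
    ext y
    simpa using (lawCDF_le_one y).trans_lt ht
  simp [genInv, this]

/-- Monotonicity holds on all of `ℝ`, as the generalised inverse is `⊥` for `t ≤ 0` and `⊤` for `t >
1`. Measurability follows without any case analysis at the endpoints. -/
lemma quantile_mono [IsProbabilityMeasure ν] : Monotone (quantile ν) := by
  intro a b hab
  unfold quantile
  split_ifs with h1 h2 h2
  · exact le_rfl
  · subst h1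
    have hb : 0 < b := lt_of_le_of_ne hab (Ne.symm h2)
    rcases le_or_gt b 1 with h | h
    · exact iInf₂_le b ⟨hb, h⟩
    · rw [genInv_of_one_lt h]; exact le_top
  · rw [genInv_of_nonpos (hab.trans h2.le)]; exact bot_le
  · exact genInv_mono hab

/-- The real-valued quantile function. -/
def quantileReal (ν : Measure ℝ) (u : ℝ) : ℝ := (quantile ν u).toReal

lemma measurable_quantileReal [IsProbabilityMeasure ν] : Measurable (quantileReal ν) :=
  measurable_ereal_toReal.comp quantile_mono.measurable

/-- Galois connection between quantile and distribution functions; right continuity of the latter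
makes the infimum attained. Finiteness on `(0, 1)`, the pushforward formula and the translation of
the constraints all rest on it. -/
lemma quantile_le_iff [IsProbabilityMeasure ν] {u : ℝ} (hu : u ∈ Set.Ioo (0 : ℝ) 1) (y : ℝ) :
    quantile ν u ≤ y ↔ u ≤ lawCDF ν y := by
  rw [quantile, if_neg hu.1.ne']
  constructor
  · intro h
    refine ge_of_tendsto (x := 𝓝[>] y) (f := lawCDF ν) ?_ ?_
    · have := (cdf ν).right_continuous y
      have h2 := this.mono (Set.Ioi_subset_Ici_self)
      rw [lawCDF_eq_cdf]
      exact h2.tendsto.congr (fun x => (lawCDF_eq_cdf x).symm)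
    · filter_upwards [self_mem_nhdsWithin] with z hz
      have : genInv ν u < (z : EReal) := h.trans_lt (EReal.coe_lt_coe_iff.2 hz)
      obtain ⟨_, ⟨w, hw, rfl⟩, hwz⟩ := sInf_lt_iff.1 this
      exact le_trans hw (lawCDF_mono (EReal.coe_lt_coe_iff.1 hwz).le)
  · intro h
    exact sInf_le ⟨y, h, rfl⟩

lemma coe_quantileReal [IsProbabilityMeasure ν] {u : ℝ} (hu : u ∈ Set.Ioo (0 : ℝ) 1) :
    (quantileReal ν u : EReal) = quantile ν u := by
  apply EReal.coe_toReal
  · obtain ⟨y, hy⟩ := ((tendsto_cdf_atTop ν).eventually (lt_mem_nhds hu.2)).exists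
    rw [← lawCDF_eq_cdf] at hy
    exact (((quantile_le_iff hu y).2 hy.le).trans_lt (EReal.coe_lt_top y)).ne
  · intro h
    obtain ⟨y, hy⟩ := ((tendsto_cdf_atBot ν).eventually (gt_mem_nhds hu.1)).exists
    rw [← lawCDF_eq_cdf] at hy
    have := (quantile_le_iff hu y).1 (by rw [h]; exact bot_le)
    exact absurd this (not_le.2 hy)

lemma quantileReal_le_iff [IsProbabilityMeasure ν] {u : ℝ} (hu : u ∈ Set.Ioo (0 : ℝ) 1) (y : ℝ) :
    quantileReal ν u ≤ y ↔ u ≤ lawCDF ν y := by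
  rw [← quantile_le_iff hu, ← coe_quantileReal hu, EReal.coe_le_coe_iff]

lemma monotoneOn_quantileReal [IsProbabilityMeasure ν] :
    MonotoneOn (quantileReal ν) (Set.Ioo 0 1) := by
  intro a ha b hb hab
  rw [← EReal.coe_le_coe_iff, coe_quantileReal ha, coe_quantileReal hb]
  exact quantile_mono hab

lemma map_quantileReal [IsProbabilityMeasure ν] : unif.map (quantileReal ν) = ν := by
  have := Measure.isProbabilityMeasure_map (μ := unif)
    (measurable_quantileReal (ν := ν)).aemeasurable
  refine Measure.ext_of_Iic _ _ fun y => ?_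
  rw [Measure.map_apply measurable_quantileReal measurableSet_Iic]
  have : unif (quantileReal ν ⁻¹' Set.Iic y) = unif (Set.Iic (lawCDF ν y)) := by
    refine measure_congr ?_
    filter_upwards [ae_unif_mem] with u hu
    exact propext (quantileReal_le_iff hu y)
  rw [this, unif_Iic ⟨lawCDF_nonneg y, lawCDF_le_one y⟩, lawCDF, ofReal_measureReal]

/-- Only `≤` needs the absence of atoms: it replaces `Iic` by `Iio`, and `Q v < Q u` forces `v < u`
by monotonicity. -/
lemma lawCDF_quantileReal [IsProbabilityMeasure ν] [NullSingletonClass ν] {u : ℝ}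
    (hu : u ∈ Set.Ioo (0 : ℝ) 1) : lawCDF ν (quantileReal ν u) = u := by
  refine le_antisymm ?_ ((quantileReal_le_iff hu _).1 le_rfl)
  rw [lawCDF, ← measureReal_congr (Iio_ae_eq_Iic (μ := ν))]
  refine ENNReal.toReal_le_of_le_ofReal hu.1.le ?_
  conv_lhs => rw [← map_quantileReal (ν := ν)]
  rw [Measure.map_apply measurable_quantileReal measurableSet_Iio, map_quantileReal]
  refine le_trans ?_ (unif_Iio_le u)
  refine measure_mono_ae ?_
  filter_upwards [ae_unif_mem] with v hv hvu
  by_contra h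
  exact absurd (monotoneOn_quantileReal hu hv (not_lt.1 h)) (not_le.2 hvu)

lemma strictMonoOn_quantileReal [IsProbabilityMeasure ν] [NullSingletonClass ν] :
    StrictMonoOn (quantileReal ν) (Set.Ioo 0 1) :=
  monotoneOn_quantileReal.strictMonoOn_of_injOn fun a ha b hb h => by
    rw [← lawCDF_quantileReal (ν := ν) ha, h, lawCDF_quantileReal hb]

end Quantile

/-! ### Optimal couplings on the line -/

/-- The squared positive part of `x - y` is the area of the square `[y, x)²`. Tonelli turns the cost
into an integral of masses of quadrants, which can be compared one at a time. -/
lemma lintegral_ofReal_sub_sq_eq (π : Measure (ℝ × ℝ)) [SFinite π] :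
    ∫⁻ z, ENNReal.ofReal (z.1 - z.2) ^ 2 ∂π =
      ∫⁻ c : ℝ × ℝ, π {z | z.2 ≤ min c.1 c.2 ∧ max c.1 c.2 < z.1} := by
  set E : Set ((ℝ × ℝ) × (ℝ × ℝ)) :=
    {w | w.1.2 ≤ min w.2.1 w.2.2 ∧ max w.2.1 w.2.2 < w.1.1} with hE
  have hmeas : MeasurableSet E :=
    (measurableSet_le (f := fun w : (ℝ × ℝ) × (ℝ × ℝ) => w.1.2)
      (g := fun w => min w.2.1 w.2.2) (by fun_prop) (by fun_prop)).inter
      (measurableSet_lt (f := fun w : (ℝ × ℝ) × (ℝ × ℝ) => max w.2.1 w.2.2)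
        (g := fun w => w.1.1) (by fun_prop) (by fun_prop))
  have h1 := Measure.prod_apply (μ := π) (ν := (volume : Measure (ℝ × ℝ))) hmeas
  have h2 := Measure.prod_apply_symm (μ := π) (ν := (volume : Measure (ℝ × ℝ))) hmeas
  rw [h1] at h2
  refine Eq.trans (lintegral_congr fun z => ?_) h2
  have : Prod.mk z ⁻¹' E = Set.Ico z.2 z.1 ×ˢ Set.Ico z.2 z.1 := by
    ext c
    simp only [hE, Set.mem_preimage, Set.mem_ofPred_eq, le_min_iff, max_lt_iff, Set.mem_prod,
      Set.mem_Ico]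
    tauto
  rw [this, Measure.volume_eq_prod, Measure.prod_prod, Real.volume_Ico, sq]

/-- Every coupling gives this quadrant at least the mass `F₂(a) - F₁(b)`, which depends on the
marginals only. The monotone coupling gives it exactly that mass, or none. -/
lemma unif_diff_le_of_coupling {T₁ T₂ : ℝ → ℝ} (h₁ : Measurable T₁) (h₂ : Measurable T₂)
    (m₁ : MonotoneOn T₁ (Set.Ioo 0 1)) (m₂ : MonotoneOn T₂ (Set.Ioo 0 1))
    {π : Measure (ℝ × ℝ)} (hπ₁ : π.map Prod.fst = unif.map T₁)
    (hπ₂ : π.map Prod.snd = unif.map T₂) (a b : ℝ) :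
    unif {u | T₂ u ≤ a ∧ b < T₁ u} ≤ π {z | z.2 ≤ a ∧ b < z.1} := by
  have e1 : π {z | z.1 ≤ b} = unif {u | T₁ u ≤ b} := by
    have := congrArg (fun m => m (Set.Iic b)) hπ₁
    simpa [Measure.map_apply measurable_fst measurableSet_Iic,
      Measure.map_apply h₁ measurableSet_Iic, Set.preimage] using this
  have e2 : π {z | z.2 ≤ a} = unif {u | T₂ u ≤ a} := by
    have := congrArg (fun m => m (Set.Iic a)) hπ₂
    simpa [Measure.map_apply measurable_snd measurableSet_Iic,
      Measure.map_apply h₂ measurableSet_Iic, Set.preimage] using this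
  by_cases hex : ∃ u ∈ Set.Ioo (0 : ℝ) 1, T₂ u ≤ a ∧ b < T₁ u
  · obtain ⟨v, hv, hva, hvb⟩ := hex
    -- One point of the quadrant suffices to nest the sublevel sets, since both are initial segments
    -- of `(0, 1)`.
    have hsub : ({u | T₁ u ≤ b} : Set ℝ) ≤ᵐ[unif] {u | T₂ u ≤ a} := by
      filter_upwards [ae_unif_mem] with u hu hub
      rcases le_total u v with h | h
      · exact (m₂ hu hv h).trans hva
      · exact absurd (m₁ hv hu h) (not_le.2 (lt_of_le_of_lt hub hvb))
    have e3 : unif {u | T₂ u ≤ a ∧ b < T₁ u} = unif {u | T₂ u ≤ a} - unif {u | T₁ u ≤ b} := by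
      have : {u | T₂ u ≤ a ∧ b < T₁ u} = {u | T₂ u ≤ a} \ {u | T₁ u ≤ b} := by
        ext u; simp
      rw [this]
      rw [← measure_inter_add_sdiff {u | T₂ u ≤ a} (measurableSet_le h₁ measurable_const)]
      have e4 : unif ({u | T₂ u ≤ a} ∩ {u | T₁ u ≤ b}) = unif {u | T₁ u ≤ b} := by
        refine measure_congr ?_
        filter_upwards [hsub] with u hu
        exact propext ⟨fun h => h.2, fun h => ⟨hu h, h⟩⟩
      rw [e4, ENNReal.add_sub_cancel_left (measure_ne_top _ _)]
    rw [e3, ← e1, ← e2]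
    refine le_trans le_measure_sdiff (measure_mono ?_)
    rintro z ⟨hz1, hz2⟩
    exact ⟨hz1, not_le.1 hz2⟩
  · have : unif {u | T₂ u ≤ a ∧ b < T₁ u} = 0 := by
      refine measure_eq_zero_iff_ae_notMem.2 ?_
      filter_upwards [ae_unif_mem] with u hu h
      exact hex ⟨u, hu, h⟩
    rw [this]; exact zero_le

lemma lintegral_posPart_sq_le_of_coupling {T₁ T₂ : ℝ → ℝ} (h₁ : Measurable T₁)
    (h₂ : Measurable T₂) (m₁ : MonotoneOn T₁ (Set.Ioo 0 1)) (m₂ : MonotoneOn T₂ (Set.Ioo 0 1))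
    {π : Measure (ℝ × ℝ)} [SFinite π] (hπ₁ : π.map Prod.fst = unif.map T₁)
    (hπ₂ : π.map Prod.snd = unif.map T₂) :
    ∫⁻ u, ENNReal.ofReal (T₁ u - T₂ u) ^ 2 ∂unif ≤ ∫⁻ z, ENNReal.ofReal (z.1 - z.2) ^ 2 ∂π := by
  have h12 : Measurable fun u => (T₁ u, T₂ u) := h₁.prodMk h₂
  have : ∫⁻ u, ENNReal.ofReal (T₁ u - T₂ u) ^ 2 ∂unif =
      ∫⁻ z, ENNReal.ofReal (z.1 - z.2) ^ 2 ∂(unif.map fun u => (T₁ u, T₂ u)) := by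
    rw [lintegral_map (by fun_prop) h12]
  rw [this, lintegral_ofReal_sub_sq_eq, lintegral_ofReal_sub_sq_eq]
  refine lintegral_mono fun c => ?_
  have hc : MeasurableSet {z : ℝ × ℝ | z.2 ≤ min c.1 c.2 ∧ max c.1 c.2 < z.1} :=
    (measurableSet_le measurable_snd measurable_const).inter
      (measurableSet_lt measurable_const measurable_fst)
  rw [Measure.map_apply h12 hc]
  exact unif_diff_le_of_coupling h₁ h₂ m₁ m₂ hπ₁ hπ₂ _ _

lemma ofReal_sub_sq (x y : ℝ) :
    ENNReal.ofReal ((x - y) ^ 2) = ENNReal.ofReal (x - y) ^ 2 + ENNReal.ofReal (y - x) ^ 2 := by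
  rcases le_total x y with h | h
  · rw [ENNReal.ofReal_of_nonpos (sub_nonpos.2 h), ← ENNReal.ofReal_pow (sub_nonneg.2 h),
      sub_sq_comm]
    simp
  · rw [ENNReal.ofReal_of_nonpos (sub_nonpos.2 h), ← ENNReal.ofReal_pow (sub_nonneg.2 h)]
    simp

/-- The square splits into its two one-sided parts; the monotone coupling minimizes each of them,
the second after swapping coordinates. -/
theorem wasserstein2Sq_map_unif {T₁ T₂ : ℝ → ℝ} (h₁ : Measurable T₁) (h₂ : Measurable T₂)
    (m₁ : MonotoneOn T₁ (Set.Ioo 0 1)) (m₂ : MonotoneOn T₂ (Set.Ioo 0 1)) :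
    wasserstein2Sq (unif.map T₁) (unif.map T₂) =
      ∫⁻ u, ENNReal.ofReal ((T₁ u - T₂ u) ^ 2) ∂unif := by
  have h12 : Measurable fun u => (T₁ u, T₂ u) := h₁.prodMk h₂
  refine le_antisymm ?_ (le_iInf₂ fun π hπ => ?_)
  · refine (iInf₂_le (unif.map fun u => (T₁ u, T₂ u)) ?_).trans_eq ?_
    · constructor
      · rw [Measure.map_map measurable_fst h12]; rfl
      · rw [Measure.map_map measurable_snd h12]; rfl
    · rw [lintegral_map (by fun_prop) h12]
  · obtain ⟨hπ₁, hπ₂⟩ := hπ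
    have hfin : IsFiniteMeasure π := by
      refine ⟨?_⟩
      have := congrArg (fun m => m Set.univ) hπ₁
      simp only [Measure.map_apply measurable_fst MeasurableSet.univ, Set.preimage_univ,
        Measure.map_apply h₁ MeasurableSet.univ] at this
      rw [this]; exact measure_lt_top _ _
    have hswap : ∫⁻ z, ENNReal.ofReal (z.1 - z.2) ^ 2 ∂(π.map Prod.swap) =
        ∫⁻ z, ENNReal.ofReal (z.2 - z.1) ^ 2 ∂π := by
      rw [lintegral_map (by fun_prop) measurable_swap]; rfl
    simp_rw [ofReal_sub_sq]
    rw [lintegral_add_left (by fun_prop), lintegral_add_left (by fun_prop), ← hswap]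
    refine add_le_add (lintegral_posPart_sq_le_of_coupling h₁ h₂ m₁ m₂ hπ₁ hπ₂)
      (lintegral_posPart_sq_le_of_coupling h₂ h₁ m₂ m₁ ?_ ?_)
    · rw [Measure.map_map measurable_fst measurable_swap]; exact hπ₂
    · rw [Measure.map_map measurable_snd measurable_swap]; exact hπ₁

/-! ### Elementary inequalities -/

lemma sq_sub_min_le {q τ α : ℝ} (h : τ ≤ α) : (q - min α q) ^ 2 ≤ (q - τ) ^ 2 := by
  rcases le_total q α with hq | hq
  · rw [min_eq_right hq]; nlinarith [sq_nonneg (q - τ)]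
  · rw [min_eq_left hq]; nlinarith

/-- Variance decomposition: a value `τ` common to all groups enters the cost only through its
distance to the weighted mean. -/
lemma sum_mul_sub_sq {ι : Type*} [Fintype ι] {w : ι → ℝ} (hw : ∑ s, w s = 1) (q : ι → ℝ) (τ : ℝ) :
    ∑ s, w s * (q s - τ) ^ 2 =
      ∑ s, w s * (q s - ∑ r, w r * q r) ^ 2 + (∑ r, w r * q r - τ) ^ 2 := by
  set m := ∑ r, w r * q r with hm
  have h : ∀ c : ℝ, ∑ s, w s * (q s - c) ^ 2 = ∑ s, w s * q s ^ 2 - 2 * c * m + c ^ 2 := by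
    intro c
    calc ∑ s, w s * (q s - c) ^ 2
        = ∑ s, (w s * q s ^ 2 - 2 * c * (w s * q s) + c ^ 2 * w s) :=
          Finset.sum_congr rfl fun s _ => by ring
      _ = _ := by
          rw [Finset.sum_add_distrib, Finset.sum_sub_distrib, ← Finset.mul_sum, ← Finset.mul_sum,
            hw, ← hm, mul_one]
  rw [h, h]; ring

lemma sq_sub_max_le {m τ α : ℝ} (h : α ≤ τ) : (m - max α m) ^ 2 ≤ (m - τ) ^ 2 := by
  rcases le_total m α with hq | hq
  · rw [max_eq_left hq]; nlinarith
  · rw [max_eq_right hq]; nlinarith [sq_nonneg (m - τ)]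

/-- Young's inequality `(a + b)² ≤ (1 + ξ) a² + (1 + 1/ξ) b²` with `|b| ≤ ξ`. The proof multiplies
the cross term by `ξ` to avoid the division. -/
lemma sq_sub_le_of_abs_sub_le {q T T' ξ : ℝ} (hξ : 0 < ξ) (h : |T' - T| ≤ ξ) :
    (q - T') ^ 2 ≤ (1 + ξ) * (q - T) ^ 2 + (ξ + ξ ^ 2) := by
  have h2 : (T' - T) ^ 2 ≤ ξ ^ 2 := sq_le_sq' (abs_le.1 h).1 (abs_le.1 h).2
  have h4 : 0 ≤ (ξ * (q - T) + (T' - T)) ^ 2 := sq_nonneg _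
  have h3 : -(2 * (q - T) * (T' - T)) * ξ ≤ (ξ * (q - T) ^ 2 + ξ) * ξ := by nlinarith
  have h5 := le_of_mul_le_mul_right h3 hξ
  nlinarith

lemma coe_finsetSum {ι : Type*} (t : Finset ι) (g : ι → ℝ) :
    ((∑ i ∈ t, g i : ℝ) : EReal) = ∑ i ∈ t, (g i : EReal) := by
  classical
  induction t using Finset.induction_on with
  | empty => simp
  | insert a t ha ih => rw [Finset.sum_insert ha, Finset.sum_insert ha, EReal.coe_add, ih]

/-! ### Conditional laws -/

section Law

set_option linter.unusedSectionVars false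

variable {Ω 𝒳 𝒮 : Type*} [MeasurableSpace Ω] [MeasurableSpace 𝒳]
  {P : Measure Ω} [IsProbabilityMeasure P] [MeasurableSpace 𝒮] [MeasurableSingletonClass 𝒮]
  {X : Ω → 𝒳} {S : Ω → 𝒮} {f g : 𝒳 × 𝒮 → ℝ} {α p : ℝ}

lemma isProbabilityMeasure_condLaw (hX : Measurable X) (hS : Measurable S) {s : 𝒮}
    (hpos : P (S ⁻¹' {s}) ≠ 0) (hg : Measurable g) : IsProbabilityMeasure (condLaw P X S g s) := by
  have := cond_isProbabilityMeasure hpos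
  exact Measure.isProbabilityMeasure_map (hg.comp (hX.prodMk hS)).aemeasurable

lemma DensityAssumption.nullSingletonClass (h : DensityAssumption P X S f) (s : 𝒮) :
    NullSingletonClass (condLaw P X S f s) := by
  obtain ⟨-, ρ, -, hρ⟩ := h s
  rw [hρ]; infer_instance

/-- The conditional quantile function of `f(X, S)` given `S = s`. -/
def condQuantile (P : Measure Ω) (X : Ω → 𝒳) (S : Ω → 𝒮) (f : 𝒳 × 𝒮 → ℝ) (s : 𝒮) : ℝ → ℝ :=
  quantileReal (condLaw P X S f s)

/-- The regressor `(x, s) ↦ T_s(F_{f|s}(f(x, s)))`. -/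
def transportPredictor (P : Measure Ω) (X : Ω → 𝒳) (S : Ω → 𝒮) (f : 𝒳 × 𝒮 → ℝ)
    (T : 𝒮 → ℝ → ℝ) : 𝒳 × 𝒮 → ℝ :=
  fun z => T z.2 (lawCDF (condLaw P X S f z.2) (f z))

variable {T : 𝒮 → ℝ → ℝ}

lemma measurable_transportPredictor [Fintype 𝒮] (hX : Measurable X) (hS : Measurable S)
    (hpos : ∀ s, P (S ⁻¹' {s}) ≠ 0) (hf : Measurable f) (hT : ∀ s, Measurable (T s)) :
    Measurable (transportPredictor P X S f T) := by
  refine measurable_from_prod_countable_left fun s => ?_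
  have := isProbabilityMeasure_condLaw hX hS (hpos s) hf
  exact (hT s).comp ((lawCDF_mono (ν := condLaw P X S f s)).measurable.comp
    (hf.comp measurable_prodMk_right))

/-- Representing `ν_{f|s}` as the image of the uniform law under its quantile function, `F_{f|s}`
undoes that map because there are no atoms. -/
lemma condLaw_transportPredictor (hX : Measurable X) (hS : Measurable S)
    (hpos : ∀ s, P (S ⁻¹' {s}) ≠ 0) (hf : Measurable f) (hd : DensityAssumption P X S f)
    (hT : ∀ s, Measurable (T s)) (s : 𝒮) :
    condLaw P X S (transportPredictor P X S f T) s = unif.map (T s) := by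
  have := isProbabilityMeasure_condLaw hX hS (hpos s) hf
  have := hd.nullSingletonClass s
  set μ := condLaw P X S f s with hμ
  have hfm : Measurable fun ω => f (X ω, S ω) := hf.comp (hX.prodMk hS)
  have hF : Measurable (T s ∘ lawCDF μ) := (hT s).comp lawCDF_mono.measurable
  have h1 : condLaw P X S (transportPredictor P X S f T) s = μ.map (T s ∘ lawCDF μ) := by
    refine Eq.trans (Measure.map_congr ?_) (Measure.map_map hF hfm).symm
    filter_upwards [ae_cond_mem (hS (measurableSet_singleton s))] with ω hω
    have : S ω = s := hω
    simp [transportPredictor, this, hμ]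
  have h2 := Measure.map_map (μ := unif) hF (measurable_quantileReal (ν := μ))
  rw [map_quantileReal] at h2
  rw [h1, h2]
  refine Measure.map_congr ?_
  filter_upwards [ae_unif_mem] with u hu
  simp [lawCDF_quantileReal hu]

lemma lintegral_cond_transportPredictor (hX : Measurable X) (hS : Measurable S)
    (hpos : ∀ s, P (S ⁻¹' {s}) ≠ 0) (hf : Measurable f) (hd : DensityAssumption P X S f)
    (hT : ∀ s, Measurable (T s)) (s : 𝒮) :
    ∫⁻ ω, ENNReal.ofReal ((f (X ω, S ω) - transportPredictor P X S f T (X ω, S ω)) ^ 2)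
        ∂(ProbabilityTheory.cond P (S ⁻¹' {s})) =
      ∫⁻ u, ENNReal.ofReal ((condQuantile P X S f s u - T s u) ^ 2) ∂unif := by
  have := isProbabilityMeasure_condLaw hX hS (hpos s) hf
  have := hd.nullSingletonClass s
  set μ := condLaw P X S f s with hμ
  have hfm : Measurable fun ω => f (X ω, S ω) := hf.comp (hX.prodMk hS)
  have hF : Measurable (T s ∘ lawCDF μ) := (hT s).comp lawCDF_mono.measurable
  have hF' : Measurable fun x => ENNReal.ofReal ((x - T s (lawCDF μ x)) ^ 2) :=
    ((measurable_id.sub hF).pow_const 2).ennreal_ofReal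
  have h1 : ∫⁻ ω, ENNReal.ofReal ((f (X ω, S ω) - transportPredictor P X S f T (X ω, S ω)) ^ 2)
        ∂(ProbabilityTheory.cond P (S ⁻¹' {s})) =
      ∫⁻ x, ENNReal.ofReal ((x - T s (lawCDF μ x)) ^ 2) ∂μ := by
    refine Eq.trans (lintegral_congr_ae ?_) (lintegral_map hF' hfm).symm
    filter_upwards [ae_cond_mem (hS (measurableSet_singleton s))] with ω hω
    have : S ω = s := hω
    simp only [transportPredictor, this, hμ]
  have h2 := lintegral_map (μ := unif) hF' (measurable_quantileReal (ν := μ))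
  rw [map_quantileReal] at h2
  rw [h1, h2]
  refine lintegral_congr_ae ?_
  filter_upwards [ae_unif_mem] with u hu
  simp only [lawCDF_quantileReal hu, condQuantile, hμ]

lemma excessRisk_eq_sum [Fintype 𝒮] (hS : Measurable S) (g : 𝒳 × 𝒮 → ℝ) :
    excessRisk P X S f g = ∑ s, P (S ⁻¹' {s}) *
      ∫⁻ ω, ENNReal.ofReal ((f (X ω, S ω) - g (X ω, S ω)) ^ 2)
        ∂(ProbabilityTheory.cond P (S ⁻¹' {s})) := by
  rw [excessRisk]
  conv_lhs => rw [← sum_meas_smul_cond_fiber hS P]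
  rw [lintegral_finsetSum_measure]
  simp_rw [lintegral_smul_measure, smul_eq_mul]

/-- The objective in terms of quantile functions, `∑ₛ pₛ ∫₀¹ (Q_{f|s} - T_s)²`. -/
def quantileCost [Fintype 𝒮] (P : Measure Ω) (X : Ω → 𝒳) (S : Ω → 𝒮) (f : 𝒳 × 𝒮 → ℝ)
    (T : 𝒮 → ℝ → ℝ) : ℝ≥0∞ :=
  ∑ s, P (S ⁻¹' {s}) * ∫⁻ u, ENNReal.ofReal ((condQuantile P X S f s u - T s u) ^ 2) ∂unif

lemma excessRisk_transportPredictor [Fintype 𝒮] (hX : Measurable X) (hS : Measurable S)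
    (hpos : ∀ s, P (S ⁻¹' {s}) ≠ 0) (hf : Measurable f) (hd : DensityAssumption P X S f)
    (hT : ∀ s, Measurable (T s)) :
    excessRisk P X S f (transportPredictor P X S f T) = quantileCost P X S f T := by
  rw [excessRisk_eq_sum hS, quantileCost]
  simp_rw [lintegral_cond_transportPredictor hX hS hpos hf hd hT]

/-- Given `S = s`, the joint law of `f(X, S)` and `g(X, S)` is one admissible coupling. -/
lemma barycenterCost_le_excessRisk [Fintype 𝒮] (hX : Measurable X) (hS : Measurable S)
    (hf : Measurable f) (hg : Measurable g) :
    barycenterCost P X S f (condLaw P X S g) ≤ excessRisk P X S f g := by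
  rw [excessRisk_eq_sum hS, barycenterCost]
  refine Finset.sum_le_sum fun s _ => mul_le_mul_right ?_ _
  have hfm : Measurable fun ω => f (X ω, S ω) := hf.comp (hX.prodMk hS)
  have hgm : Measurable fun ω => g (X ω, S ω) := hg.comp (hX.prodMk hS)
  have hfg := hfm.prodMk hgm
  refine (iInf₂_le ((ProbabilityTheory.cond P (S ⁻¹' {s})).map
    fun ω => (f (X ω, S ω), g (X ω, S ω))) ?_).trans_eq ?_
  · constructor
    · rw [Measure.map_map measurable_fst hfg]; rfl
    · rw [Measure.map_map measurable_snd hfg]; rfl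
  · rw [lintegral_map (by fun_prop) hfg]

lemma barycenterCost_map_unif [Fintype 𝒮] (hX : Measurable X) (hS : Measurable S)
    (hpos : ∀ s, P (S ⁻¹' {s}) ≠ 0) (hf : Measurable f)
    (hT : ∀ s, Measurable (T s)) (hmono : ∀ s, MonotoneOn (T s) (Set.Ioo 0 1)) :
    barycenterCost P X S f (fun s => unif.map (T s)) = quantileCost P X S f T := by
  rw [barycenterCost, quantileCost]
  refine Finset.sum_congr rfl fun s _ => ?_
  have := isProbabilityMeasure_condLaw hX hS (hpos s) hf
  have h := wasserstein2Sq_map_unif (measurable_quantileReal (ν := condLaw P X S f s)) (hT s)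
    monotoneOn_quantileReal (hmono s)
  rw [map_quantileReal] at h
  rw [h, condQuantile]

lemma barycenterCost_eq_quantileCost [Fintype 𝒮] (hX : Measurable X) (hS : Measurable S)
    (hpos : ∀ s, P (S ⁻¹' {s}) ≠ 0) (hf : Measurable f) (ν : 𝒮 → Measure ℝ)
    [∀ s, IsProbabilityMeasure (ν s)] :
    barycenterCost P X S f ν = quantileCost P X S f (fun s => quantileReal (ν s)) := by
  rw [← barycenterCost_map_unif hX hS hpos hf (fun s => measurable_quantileReal)
    (fun s => monotoneOn_quantileReal)]
  simp_rw [map_quantileReal]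

/-! ### The two constraint classes in terms of quantile functions -/

/-- The constraints on quantile functions: below `α` up to `p`, and common and above `α` after
`p`. -/
def IsTailCommon (α p : ℝ) (T : 𝒮 → ℝ → ℝ) : Prop :=
  ∀ u ∈ Set.Ioo (0 : ℝ) 1, (u ≤ p → ∀ s, T s u ≤ α) ∧
    (p < u → (∀ s, α < T s u) ∧ ∀ s s', T s u = T s' u)

lemma lawCDF_map_unif (s : 𝒮) (hT : Measurable (T s)) (y : ℝ) :
    lawCDF (unif.map (T s)) y = unif.real {u | T s u ≤ y} := by
  rw [lawCDF, map_measureReal_apply hT measurableSet_Iic]; rfl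

lemma IsTailCommon.transportPredictor_mem_fairClass [Fintype 𝒮] (hT' : IsTailCommon α p T)
    (hp : p ∈ Set.Icc (0 : ℝ) 1) (hX : Measurable X) (hS : Measurable S)
    (hpos : ∀ s, P (S ⁻¹' {s}) ≠ 0) (hf : Measurable f) (hd : DensityAssumption P X S f)
    (hT : ∀ s, Measurable (T s)) :
    transportPredictor P X S f T ∈ fairClass P X S α p := by
  refine ⟨measurable_transportPredictor hX hS hpos hf hT, fun s s' t ht => ?_, fun s => ?_⟩
  · rw [condLaw_transportPredictor hX hS hpos hf hd hT,
      condLaw_transportPredictor hX hS hpos hf hd hT, lawCDF_map_unif s (hT s),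
      lawCDF_map_unif s' (hT s')]
    refine measureReal_congr ?_
    filter_upwards [ae_unif_mem] with u hu
    refine propext ?_
    change T s u ≤ t ↔ T s' u ≤ t
    rcases le_or_gt u p with h | h
    · exact iff_of_true (((hT' u hu).1 h s).trans ht) (((hT' u hu).1 h s').trans ht)
    · rw [((hT' u hu).2 h).2 s s']
  · rw [condLaw_transportPredictor hX hS hpos hf hd hT, lawCDF_map_unif s (hT s)]
    have : unif.real {u | T s u ≤ α} = unif.real (Set.Iic p) := by
      refine measureReal_congr ?_
      filter_upwards [ae_unif_mem] with u hu
      refine propext ?_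
      change T s u ≤ α ↔ u ≤ p
      rcases le_or_gt u p with h | h
      · exact iff_of_true ((hT' u hu).1 h s) h
      · exact iff_of_false (not_le.2 (((hT' u hu).2 h).1 s)) (not_le.2 h)
    rw [this, measureReal_def, unif_Iic hp, ENNReal.toReal_ofReal hp.1]

lemma isProbabilityMeasure_of_mem_measureClass {ν : 𝒮 → Measure ℝ}
    (h : ν ∈ measureClass 𝒮 α p) (s : 𝒮) : IsProbabilityMeasure (ν s) := by
  obtain ⟨νp, νm, -, -, h3, h4⟩ := h
  exact ⟨by rw [h4 s, Measure.add_apply, (h3 s).1]⟩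

lemma measure_Iic_of_mem_measureClass {ν : 𝒮 → Measure ℝ} {νp : Measure ℝ} {νm : 𝒮 → Measure ℝ}
    (h2 : ∀ s, νm s (Set.Ioi α) = 0) (h3 : ∀ s, νm s Set.univ = ENNReal.ofReal p)
    (h4 : ∀ s, ν s = νp + νm s) (s : 𝒮) {y : ℝ} (hy : α ≤ y) :
    ν s (Set.Iic y) = νp (Set.Iic y) + ENNReal.ofReal p := by
  rw [h4 s, Measure.add_apply, ← h3 s]
  congr 1
  refine measure_congr (ae_eq_univ.2 (measure_mono_null ?_ (h2 s)))
  rw [Set.compl_Iic]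
  exact Set.Ioi_subset_Ioi hy

/-- All `ν s` have the same distribution function on `[α, ∞)`, with value `p` at `α`; the Galois
connection carries this over to quantiles. -/
lemma isTailCommon_quantileReal {ν : 𝒮 → Measure ℝ} (h : ν ∈ measureClass 𝒮 α p)
    (hp : p ∈ Set.Icc (0 : ℝ) 1) : IsTailCommon α p (fun s => quantileReal (ν s)) := by
  have hprob := isProbabilityMeasure_of_mem_measureClass h
  obtain ⟨νp, νm, h1, h2, h3, h4⟩ := h
  have hF : ∀ s, ∀ y, α ≤ y → ν s (Set.Iic y) = νp (Set.Iic y) + ENNReal.ofReal p :=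
    fun s y hy => measure_Iic_of_mem_measureClass h2 (fun s => (h3 s).2) h4 s hy
  have hα : ∀ s, lawCDF (ν s) α = p := fun s => by
    rw [lawCDF, measureReal_def, hF s α le_rfl, h1, zero_add, ENNReal.toReal_ofReal hp.1]
  -- A quantile above `α` lies where the distribution functions agree, so it bounds the quantile of
  -- any other group; exchanging the groups gives equality.
  have hle : ∀ s s' u, u ∈ Set.Ioo (0 : ℝ) 1 → α < quantileReal (ν s) u →
      quantileReal (ν s') u ≤ quantileReal (ν s) u := by
    intro s s' u hu hlt
    rw [quantileReal_le_iff hu, lawCDF, measureReal_def, hF s' _ hlt.le, ← hF s _ hlt.le,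
      ← measureReal_def]
    exact (quantileReal_le_iff hu _).1 le_rfl
  intro u hu
  refine ⟨fun hup s => ?_, fun hup => ?_⟩
  · rw [quantileReal_le_iff hu, hα]; exact hup
  · have hgt : ∀ s, α < quantileReal (ν s) u := fun s => by
      rw [← not_le, quantileReal_le_iff hu, hα]; exact not_le.2 hup
    exact ⟨hgt, fun s s' => le_antisymm (hle s' s u hu (hgt s')) (hle s s' u hu (hgt s))⟩

/-- Equal distribution functions on `[α, ∞)` determine the restrictions to `(α, ∞)`, so any group
can supply `ν⁺`. -/
lemma condLaw_mem_measureClass (hX : Measurable X) (hS : Measurable S)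
    (hpos : ∀ s, P (S ⁻¹' {s}) ≠ 0)
    (hg : g ∈ fairClass P X S α p) : condLaw P X S g ∈ measureClass 𝒮 α p := by
  obtain ⟨hgm, hg1, hg2⟩ := hg
  have hprob := fun s => isProbabilityMeasure_condLaw hX hS (hpos s) hgm
  obtain ⟨ω⟩ : Nonempty Ω := nonempty_of_isProbabilityMeasure P
  have hIic : ∀ s s' t, α ≤ t →
      condLaw P X S g s (Set.Iic t) = condLaw P X S g s' (Set.Iic t) := fun s s' t ht => by
    rw [← ofReal_measureReal, ← ofReal_measureReal]
    exact congrArg _ (hg1 s s' t ht)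
  have hα : ∀ s, condLaw P X S g s (Set.Iic α) = ENNReal.ofReal p := fun s => by
    rw [← ofReal_measureReal]
    exact congrArg _ (hg2 s)
  have htail : ∀ s s', (condLaw P X S g s).restrict (Set.Ioi α) =
      (condLaw P X S g s').restrict (Set.Ioi α) := by
    intro s s'
    have key : ∀ r t, (condLaw P X S g r).restrict (Set.Ioi α) (Set.Iic t) =
        condLaw P X S g r (Set.Iic (max α t)) - ENNReal.ofReal p := by
      intro r t
      rw [Measure.restrict_apply measurableSet_Iic, ← hα r,
        ← measure_sdiff (Set.Iic_subset_Iic.2 (le_max_left _ _))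
          measurableSet_Iic.nullMeasurableSet (measure_ne_top _ _)]
      congr 1
      ext x
      simp only [Set.mem_inter_iff, Set.mem_Iic, Set.mem_Ioi, Set.mem_sdiff, le_max_iff, not_le]
      constructor
      · rintro ⟨h1, h2⟩; exact ⟨Or.inr h1, h2⟩
      · rintro ⟨h1 | h1, h2⟩
        · exact absurd h1 (not_le.2 h2)
        · exact ⟨h1, h2⟩
    refine Measure.ext_of_Iic _ _ fun t => ?_
    rw [key, key, hIic s s' _ (le_max_left _ _)]
  have hadd : ∀ s, condLaw P X S g s =
      (condLaw P X S g s).restrict (Set.Ioi α) + (condLaw P X S g s).restrict (Set.Iic α) := by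
    intro s
    have := Measure.restrict_add_restrict_compl (μ := condLaw P X S g s)
      (measurableSet_Ioi (a := α))
    rw [Set.compl_Ioi] at this
    exact this.symm
  refine ⟨(condLaw P X S g (S ω)).restrict (Set.Ioi α),
    fun s => (condLaw P X S g s).restrict (Set.Iic α), ?_, fun s => ?_, fun s => ⟨?_, ?_⟩,
    fun s => ?_⟩
  · rw [Measure.restrict_apply measurableSet_Iic, Set.inter_comm, Set.Ioi_inter_Iic]; simp
  · rw [Measure.restrict_apply measurableSet_Ioi, Set.Ioi_inter_Iic]; simp
  · rw [htail _ s, ← Measure.add_apply, ← hadd, measure_univ]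
  · rw [Measure.restrict_apply_univ, hα]
  · rw [htail _ s]; exact hadd s

end Law

/-! ### The pointwise optimization problem -/

section Optimization

set_option linter.unusedSectionVars false

variable {Ω 𝒳 𝒮 : Type*} [MeasurableSpace Ω] [MeasurableSpace 𝒳]
  {P : Measure Ω} [IsProbabilityMeasure P] [Fintype 𝒮] [MeasurableSpace 𝒮]
  [MeasurableSingletonClass 𝒮]
  {X : Ω → 𝒳} {S : Ω → 𝒮} {f : 𝒳 × 𝒮 → ℝ} {α β p : ℝ} {T : 𝒮 → ℝ → ℝ}

/-- The real-valued version of `clippedQuantile`. -/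
def clippedReal (P : Measure Ω) (X : Ω → 𝒳) (S : Ω → 𝒮) (f : 𝒳 × 𝒮 → ℝ) (α β p : ℝ)
    (s : 𝒮) (u : ℝ) : ℝ :=
  (clippedQuantile P X S f α β p s u).toReal

lemma clippedPredictor_eq :
    clippedPredictor P X S f α β p = transportPredictor P X S f (clippedReal P X S f α β p) :=
  rfl

/-- The average `∑ₛ pₛ Q_{f|s}` as a real number. -/
def meanQuantile (P : Measure Ω) (X : Ω → 𝒳) (S : Ω → 𝒮) (f : 𝒳 × 𝒮 → ℝ) (u : ℝ) : ℝ :=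
  ∑ s, P.real (S ⁻¹' {s}) * condQuantile P X S f s u

/-- The integrand of `quantileCost`. -/
def costDensity (P : Measure Ω) (X : Ω → 𝒳) (S : Ω → 𝒮) (f : 𝒳 × 𝒮 → ℝ) (T : 𝒮 → ℝ → ℝ)
    (u : ℝ) : ℝ :=
  ∑ s, P.real (S ⁻¹' {s}) * (condQuantile P X S f s u - T s u) ^ 2

lemma costDensity_nonneg (u : ℝ) : 0 ≤ costDensity P X S f T u :=
  Finset.sum_nonneg fun _ _ => mul_nonneg measureReal_nonneg (sq_nonneg _)

lemma sum_weights (hS : Measurable S) : ∑ s, P.real (S ⁻¹' {s}) = 1 := by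
  have h := sum_measureReal_preimage_singleton (μ := P) (f := S) Finset.univ
    (fun s _ => hS (measurableSet_singleton s))
  simpa using h

section

variable (hX : Measurable X) (hS : Measurable S) (hpos : ∀ s, P (S ⁻¹' {s}) ≠ 0)
  (hf : Measurable f)
include hX hS hpos hf

lemma avgQuantile_mono : Monotone (avgQuantile P X S f) := by
  intro a b hab
  refine Finset.sum_le_sum fun s _ => mul_le_mul_of_nonneg_left ?_
    (by exact_mod_cast measureReal_nonneg)
  have := isProbabilityMeasure_condLaw hX hS (hpos s) hf
  exact quantile_mono hab

lemma coe_meanQuantile {u : ℝ} (hu : u ∈ Set.Ioo (0 : ℝ) 1) :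
    (meanQuantile P X S f u : EReal) = avgQuantile P X S f u := by
  rw [meanQuantile, avgQuantile, coe_finsetSum]
  refine Finset.sum_congr rfl fun s _ => ?_
  have := isProbabilityMeasure_condLaw hX hS (hpos s) hf
  rw [EReal.coe_mul, condQuantile, coe_quantileReal hu]

lemma measurable_condQuantile (s : 𝒮) : Measurable (condQuantile P X S f s) := by
  have := isProbabilityMeasure_condLaw hX hS (hpos s) hf
  exact measurable_quantileReal

lemma measurable_clippedReal (s : 𝒮) : Measurable (clippedReal P X S f α β p s) := by
  have := isProbabilityMeasure_condLaw hX hS (hpos s) hf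
  refine measurable_ereal_toReal.comp (Measurable.ite measurableSet_Iic ?_ ?_)
  · exact measurable_const.min quantile_mono.measurable
  · exact measurable_const.max (avgQuantile_mono hX hS hpos hf).measurable

lemma clippedReal_eq_min {u : ℝ} (hu : u ∈ Set.Ioo (0 : ℝ) 1) (hup : u ≤ p) (s : 𝒮) :
    clippedReal P X S f α β p s u = min α (condQuantile P X S f s u) := by
  have := isProbabilityMeasure_condLaw hX hS (hpos s) hf
  rw [clippedReal, clippedQuantile, if_pos hup, ← coe_quantileReal hu,
    ← EReal.coe_strictMono.monotone.map_min, EReal.toReal_coe, condQuantile]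

lemma clippedReal_eq_max {u : ℝ} (hu : u ∈ Set.Ioo (0 : ℝ) 1) (hup : p < u) (s : 𝒮) :
    clippedReal P X S f α β p s u = max β (meanQuantile P X S f u) := by
  rw [clippedReal, clippedQuantile, if_neg (not_le.2 hup), ← coe_meanQuantile hX hS hpos hf hu,
    ← EReal.coe_strictMono.monotone.map_max, EReal.toReal_coe]

lemma monotoneOn_condQuantile (s : 𝒮) : MonotoneOn (condQuantile P X S f s) (Set.Ioo 0 1) := by
  have := isProbabilityMeasure_condLaw hX hS (hpos s) hf
  exact monotoneOn_quantileReal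

lemma monotoneOn_meanQuantile : MonotoneOn (meanQuantile P X S f) (Set.Ioo 0 1) :=
  fun _ ha _ hb hab => Finset.sum_le_sum fun s _ => mul_le_mul_of_nonneg_left
    (monotoneOn_condQuantile hX hS hpos hf s ha hb hab) measureReal_nonneg

lemma strictMonoOn_meanQuantile [Nonempty 𝒮] (hd : DensityAssumption P X S f) :
    StrictMonoOn (meanQuantile P X S f) (Set.Ioo 0 1) := by
  intro a ha b hb hab
  refine Finset.sum_lt_sum_of_nonempty Finset.univ_nonempty fun s _ => ?_
  have := isProbabilityMeasure_condLaw hX hS (hpos s) hf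
  have := hd.nullSingletonClass s
  refine mul_lt_mul_of_pos_left (strictMonoOn_quantileReal ha hb hab) ?_
  exact ENNReal.toReal_pos (hpos s) (measure_ne_top _ _)

lemma monotoneOn_clippedReal (hβ : α ≤ β) (s : 𝒮) :
    MonotoneOn (clippedReal P X S f α β p s) (Set.Ioo 0 1) := by
  intro a ha b hb hab
  rcases le_or_gt b p with h | h
  · rw [clippedReal_eq_min hX hS hpos hf ha (hab.trans h),
      clippedReal_eq_min hX hS hpos hf hb h]
    exact min_le_min le_rfl (monotoneOn_condQuantile hX hS hpos hf s ha hb hab)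
  · rw [clippedReal_eq_max hX hS hpos hf hb h]
    rcases le_or_gt a p with h' | h'
    · rw [clippedReal_eq_min hX hS hpos hf ha h']
      exact (min_le_left _ _).trans (hβ.trans (le_max_left _ _))
    · rw [clippedReal_eq_max hX hS hpos hf ha h']
      exact max_le_max le_rfl (monotoneOn_meanQuantile hX hS hpos hf ha hb hab)

lemma measurable_costDensity (hT : ∀ s, Measurable (T s)) :
    Measurable (costDensity P X S f T) :=
  Finset.measurable_fun_sum _ fun s _ =>
    (((measurable_condQuantile hX hS hpos hf s).sub (hT s)).pow_const 2).const_mul _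

lemma quantileCost_eq_lintegral (hT : ∀ s, Measurable (T s)) :
    quantileCost P X S f T = ∫⁻ u, ENNReal.ofReal (costDensity P X S f T u) ∂unif := by
  have hm : ∀ s, Measurable fun u =>
      ENNReal.ofReal ((condQuantile P X S f s u - T s u) ^ 2) := fun s =>
    (((measurable_condQuantile hX hS hpos hf s).sub (hT s)).pow_const 2).ennreal_ofReal
  have : ∀ u, ENNReal.ofReal (costDensity P X S f T u) =
      ∑ s, P (S ⁻¹' {s}) * ENNReal.ofReal ((condQuantile P X S f s u - T s u) ^ 2) := by
    intro u
    rw [costDensity, ENNReal.ofReal_sum_of_nonneg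
      fun _ _ => mul_nonneg measureReal_nonneg (sq_nonneg _)]
    refine Finset.sum_congr rfl fun s _ => ?_
    rw [ENNReal.ofReal_mul measureReal_nonneg, ofReal_measureReal]
  simp_rw [this]
  rw [lintegral_finsetSum _ fun s _ => (hm s).const_mul _, quantileCost]
  refine Finset.sum_congr rfl fun s _ => ?_
  rw [lintegral_const_mul _ (hm s)]

lemma costDensity_of_common {u : ℝ} {τ : ℝ} (h : ∀ s, T s u = τ) :
    costDensity P X S f T u =
      ∑ s, P.real (S ⁻¹' {s}) * (condQuantile P X S f s u - meanQuantile P X S f u) ^ 2 +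
        (meanQuantile P X S f u - τ) ^ 2 := by
  simp_rw [costDensity, h]
  exact sum_mul_sub_sq (sum_weights hS) _ _

/-- Pointwise projection. The closed constraint `α ≤ τ` suffices, so the constant `α` is also a
competitor, which yields finiteness of the optimal cost. -/
lemma costDensity_clippedReal_le {u : ℝ} (hu : u ∈ Set.Ioo (0 : ℝ) 1)
    (h₁ : u ≤ p → ∀ s, T s u ≤ α) (h₂ : p < u → ∃ τ, α ≤ τ ∧ ∀ s, T s u = τ) :
    costDensity P X S f (clippedReal P X S f α α p) u ≤ costDensity P X S f T u := by
  rcases le_or_gt u p with h | h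
  · refine Finset.sum_le_sum fun s _ => mul_le_mul_of_nonneg_left ?_ measureReal_nonneg
    rw [clippedReal_eq_min hX hS hpos hf hu h]
    exact sq_sub_min_le (h₁ h s)
  · obtain ⟨τ, hτ, hT⟩ := h₂ h
    rw [costDensity_of_common hX hS hpos hf hT,
      costDensity_of_common hX hS hpos hf (fun s => clippedReal_eq_max hX hS hpos hf hu h s)]
    exact add_le_add le_rfl (sq_sub_max_le hτ)

lemma costDensity_clippedReal_lt {u : ℝ} (hu : u ∈ Set.Ioo (0 : ℝ) 1) (h : p < u) {τ : ℝ}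
    (hτ : α < τ) (hT : ∀ s, T s u = τ) (hm : meanQuantile P X S f u < α) :
    costDensity P X S f (clippedReal P X S f α α p) u < costDensity P X S f T u := by
  rw [costDensity_of_common hX hS hpos hf hT,
    costDensity_of_common hX hS hpos hf (fun s => clippedReal_eq_max hX hS hpos hf hu h s),
    max_eq_left hm.le]
  gcongr ?_ + ?_
  nlinarith

lemma quantileCost_clippedReal_le [Nonempty 𝒮] (hT : ∀ s, Measurable (T s))
    (hT' : IsTailCommon α p T) :
    quantileCost P X S f (clippedReal P X S f α α p) ≤ quantileCost P X S f T := by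
  rw [quantileCost_eq_lintegral hX hS hpos hf (measurable_clippedReal hX hS hpos hf),
    quantileCost_eq_lintegral hX hS hpos hf hT]
  refine lintegral_mono_ae ?_
  filter_upwards [ae_unif_mem] with u hu
  refine ENNReal.ofReal_le_ofReal (costDensity_clippedReal_le hX hS hpos hf hu (hT' u hu).1 ?_)
  intro h
  obtain ⟨h1, h2⟩ := (hT' u hu).2 h
  inhabit 𝒮
  exact ⟨T default u, (h1 _).le, fun s => h2 s _⟩

lemma quantileCost_clippedReal_ne_top (hd : DensityAssumption P X S f) :
    quantileCost P X S f (clippedReal P X S f α α p) ≠ ∞ := by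
  have h : quantileCost P X S f (clippedReal P X S f α α p) ≤
      quantileCost P X S f (fun _ _ => α) := by
    rw [quantileCost_eq_lintegral hX hS hpos hf (measurable_clippedReal hX hS hpos hf),
      quantileCost_eq_lintegral hX hS hpos hf (fun _ => measurable_const)]
    refine lintegral_mono_ae ?_
    filter_upwards [ae_unif_mem] with u hu
    exact ENNReal.ofReal_le_ofReal (costDensity_clippedReal_le hX hS hpos hf hu
      (fun _ _ => le_rfl) fun _ => ⟨α, le_rfl, fun _ => rfl⟩)
  refine ne_top_of_le_ne_top (ENNReal.sum_ne_top.2 fun s _ =>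
    ENNReal.mul_ne_top (measure_ne_top _ _) ?_) h
  have := isProbabilityMeasure_condLaw hX hS (hpos s) hf
  set μ := condLaw P X S f s with hμ
  have h1 := lintegral_map (μ := unif) (f := fun x => ENNReal.ofReal ((x - α) ^ 2)) (by fun_prop)
    (measurable_quantileReal (ν := μ))
  rw [map_quantileReal] at h1
  have h2 : MemLp (fun y : ℝ => y - α) 2 μ := (hd s).1.sub (memLp_const α)
  have h3 := h2.integrable_sq.lintegral_lt_top
  rw [h1] at h3
  exact h3.ne

/-- By monotonicity the mean quantile stays below `α` on all of `(p, t)`, a set of positive measure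
where the pointwise comparison is strict. Finiteness of the smaller cost preserves strictness under
integration. -/
lemma quantileCost_clippedReal_lt [Nonempty 𝒮] (hd : DensityAssumption P X S f) (hp : 0 ≤ p)
    (hT : ∀ s, Measurable (T s)) (hT' : IsTailCommon α p T) {t : ℝ} (ht : t ∈ Set.Ioo p 1)
    (hm : meanQuantile P X S f t < α) :
    quantileCost P X S f (clippedReal P X S f α α p) < quantileCost P X S f T := by
  have hfin := quantileCost_clippedReal_ne_top hX hS hpos hf hd (α := α) (p := p)
  rw [quantileCost_eq_lintegral hX hS hpos hf (measurable_clippedReal hX hS hpos hf)] at hfin ⊢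
  rw [quantileCost_eq_lintegral hX hS hpos hf hT]
  inhabit 𝒮
  refine lintegral_strict_mono_of_ae_le_of_ae_lt_on (s := Set.Ioo p t)
    (measurable_costDensity hX hS hpos hf hT).ennreal_ofReal.aemeasurable hfin ?_ ?_ ?_
  · filter_upwards [ae_unif_mem] with u hu
    refine ENNReal.ofReal_le_ofReal (costDensity_clippedReal_le hX hS hpos hf hu (hT' u hu).1 ?_)
    intro h
    obtain ⟨h1, h2⟩ := (hT' u hu).2 h
    exact ⟨T default u, (h1 _).le, fun s => h2 s _⟩
  · rw [unif, Measure.restrict_apply measurableSet_Ioo,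
      Set.inter_eq_left.2 (Set.Ioo_subset_Ioo hp ht.2.le), Real.volume_Ioo]
    simpa using ht.1
  · filter_upwards [ae_unif_mem] with u hu hut
    obtain ⟨h1, h2⟩ := (hT' u hu).2 hut.1
    have hlt := costDensity_clippedReal_lt hX hS hpos hf hu hut.1 (h1 default)
      (fun s => h2 s _) (lt_of_le_of_lt (monotoneOn_meanQuantile hX hS hpos hf hu
        ⟨hp.trans_lt ht.1, ht.2⟩ hut.2.le) hm)
    exact (ENNReal.ofReal_lt_ofReal_iff ((costDensity_nonneg u).trans_lt hlt)).2 hlt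

lemma quantileCost_clippedReal_add_le {ξ : ℝ} (hξ : 0 < ξ) :
    quantileCost P X S f (clippedReal P X S f α (α + ξ) p) ≤
      ENNReal.ofReal (1 + ξ) * quantileCost P X S f (clippedReal P X S f α α p) +
        ENNReal.ofReal (ξ + ξ ^ 2) := by
  have hm := measurable_costDensity hX hS hpos hf
    (measurable_clippedReal hX hS hpos hf (α := α) (β := α) (p := p))
  rw [quantileCost_eq_lintegral hX hS hpos hf (measurable_clippedReal hX hS hpos hf),
    quantileCost_eq_lintegral hX hS hpos hf (measurable_clippedReal hX hS hpos hf)]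
  have hc : ENNReal.ofReal (ξ + ξ ^ 2) = ∫⁻ _, ENNReal.ofReal (ξ + ξ ^ 2) ∂unif := by simp
  rw [hc, ← lintegral_const_mul _ hm.ennreal_ofReal,
    ← lintegral_add_right _ measurable_const]
  refine lintegral_mono_ae ?_
  filter_upwards [ae_unif_mem] with u hu
  rw [← ENNReal.ofReal_mul (by positivity),
    ← ENNReal.ofReal_add (mul_nonneg (by positivity) (costDensity_nonneg u)) (by positivity)]
  refine ENNReal.ofReal_le_ofReal ?_
  have hclose : ∀ s, |clippedReal P X S f α (α + ξ) p s u - clippedReal P X S f α α p s u| ≤ ξ := by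
    intro s
    rcases le_or_gt u p with h | h
    · rw [clippedReal_eq_min hX hS hpos hf hu h, clippedReal_eq_min hX hS hpos hf hu h]
      simpa using hξ.le
    · rw [clippedReal_eq_max hX hS hpos hf hu h, clippedReal_eq_max hX hS hpos hf hu h]
      refine (abs_max_sub_max_le_abs _ _ _).trans ?_
      simp [abs_of_pos hξ]
  calc costDensity P X S f (clippedReal P X S f α (α + ξ) p) u
      ≤ ∑ s, P.real (S ⁻¹' {s}) * ((1 + ξ) *
          (condQuantile P X S f s u - clippedReal P X S f α α p s u) ^ 2 + (ξ + ξ ^ 2)) :=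
        Finset.sum_le_sum fun s _ => mul_le_mul_of_nonneg_left
          (sq_sub_le_of_abs_sub_le hξ (hclose s)) measureReal_nonneg
    _ = (1 + ξ) * costDensity P X S f (clippedReal P X S f α α p) u +
          (∑ s, P.real (S ⁻¹' {s})) * (ξ + ξ ^ 2) := by
        rw [costDensity, Finset.mul_sum, Finset.sum_mul, ← Finset.sum_add_distrib]
        exact Finset.sum_congr rfl fun s _ => by ring
    _ = _ := by rw [sum_weights hS, one_mul]

lemma isTailCommon_clippedReal
    (h : ∀ u ∈ Set.Ioo (0 : ℝ) 1, p < u → α < max β (meanQuantile P X S f u)) :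
    IsTailCommon α p (clippedReal P X S f α β p) := by
  intro u hu
  refine ⟨fun hup s => ?_, fun hup => ⟨fun s => ?_, fun s s' => ?_⟩⟩
  · rw [clippedReal_eq_min hX hS hpos hf hu hup]; exact min_le_left _ _
  · rw [clippedReal_eq_max hX hS hpos hf hu hup]; exact h u hu hup
  · rw [clippedReal_eq_max hX hS hpos hf hu hup, clippedReal_eq_max hX hS hpos hf hu hup]

lemma isTailCommon_clippedReal_add {ξ : ℝ} (hξ : 0 < ξ) :
    IsTailCommon α p (clippedReal P X S f α (α + ξ) p) :=
  isTailCommon_clippedReal hX hS hpos hf fun _ _ _ =>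
    lt_of_lt_of_le (lt_add_of_pos_right α hξ) (le_max_left _ _)

end

/-- Passage to the limit `ξ → 0⁺`, turning the bound for the perturbed regressors into a bound by
the optimal cost itself. -/
lemma le_of_forall_le_mul_add {a b : ℝ≥0∞} (hb : b ≠ ∞)
    (h : ∀ ξ : ℝ, 0 < ξ → a ≤ ENNReal.ofReal (1 + ξ) * b + ENNReal.ofReal (ξ + ξ ^ 2)) :
    a ≤ b := by
  have hlim : Tendsto (fun ξ : ℝ => ENNReal.ofReal (1 + ξ) * b + ENNReal.ofReal (ξ + ξ ^ 2))
      (𝓝[>] 0) (𝓝 (ENNReal.ofReal (1 + 0) * b + ENNReal.ofReal (0 + 0 ^ 2))) := by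
    refine Tendsto.mono_left (Tendsto.add (ENNReal.Tendsto.mul_const ?_ (Or.inr hb)) ?_)
      nhdsWithin_le_nhds
    · exact ENNReal.tendsto_ofReal (Continuous.tendsto (by fun_prop) 0)
    · exact ENNReal.tendsto_ofReal (Continuous.tendsto (f := fun ξ : ℝ => ξ + ξ ^ 2)
        (by fun_prop) 0)
  have := ge_of_tendsto hlim (by filter_upwards [self_mem_nhdsWithin] with ξ hξ using h ξ hξ)
  simpa using this

end Optimization

end DPTails

end

/-! ### Values of the two problems and attainment -/

open DPTails

theorem theorem2 {Ω 𝒮 : Type*} [MeasurableSpace Ω] (P : Measure Ω) [IsProbabilityMeasure P]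
    [Fintype 𝒮] [MeasurableSpace 𝒮] [MeasurableSingletonClass 𝒮] {d : ℕ}
    (X : Ω → EuclideanSpace ℝ (Fin d)) (hX : Measurable X)
    (S : Ω → 𝒮) (hS : Measurable S) (hpos : ∀ s : 𝒮, P (S ⁻¹' {s}) ≠ 0)
    (f : EuclideanSpace ℝ (Fin d) × 𝒮 → ℝ) (hf : Measurable f)
    (hdens : DPTails.DensityAssumption P X S f)
    (α p : ℝ) (hp : p ∈ Set.Icc (0 : ℝ) 1) :
    -- the infimum is the (finite) risk of `g*`
    (DPTails.excessRisk P X S f (DPTails.optPredictor P X S f α p) ≠ ∞ ∧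
      (⨅ g ∈ DPTails.fairClass P X S α p, DPTails.excessRisk P X S f g) =
        DPTails.excessRisk P X S f (DPTails.optPredictor P X S f α p)) ∧
    -- the infimum of the barycenter problem is its value at the conditional laws of `g*`
    (⨅ ν ∈ DPTails.measureClass 𝒮 α p, DPTails.barycenterCost P X S f ν) =
      DPTails.barycenterCost P X S f
        (DPTails.condLaw P X S (DPTails.optPredictor P X S f α p)) ∧
    -- the attained case
    ((α : EReal) ≤ DPTails.avgQuantile P X S f p →
      DPTails.IsFairMinimizer P X S f α p (DPTails.optPredictor P X S f α p) ∧
      DPTails.condLaw P X S (DPTails.optPredictor P X S f α p) ∈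
        DPTails.measureClass 𝒮 α p) ∧
    -- otherwise there is no minimizer, if `p < 1` and the averaged quantile has no jump at `p`
    (p < 1 → ContinuousWithinAt (DPTails.avgQuantile P X S f) (Set.Ioc p 1) p →
      DPTails.avgQuantile P X S f p < (α : EReal) →
      DPTails.optPredictor P X S f α p ∉ DPTails.fairClass P X S α p ∧
      ¬ ∃ g, DPTails.IsFairMinimizer P X S f α p g) ∧
    -- the exact dichotomy, for every `p` and every density
    ((DPTails.optPredictor P X S f α p ∈ DPTails.fairClass P X S α p ↔
        ∀ t ∈ Set.Ioc p 1, (α : EReal) ≤ DPTails.avgQuantile P X S f t) ∧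
      ((∃ g, DPTails.IsFairMinimizer P X S f α p g) ↔
        ∀ t ∈ Set.Ioc p 1, (α : EReal) ≤ DPTails.avgQuantile P X S f t)) ∧
    -- the variants that are always fair
    (∀ ξ : ℝ, 0 < ξ →
      DPTails.xiPredictor P X S f α p ξ ∈ DPTails.fairClass P X S α p ∧
      DPTails.excessRisk P X S f (DPTails.xiPredictor P X S f α p ξ) ≠ ∞) ∧
    (fun ξ : ℝ =>
      |(DPTails.excessRisk P X S f (DPTails.xiPredictor P X S f α p ξ)).toReal -
        (DPTails.excessRisk P X S f (DPTails.optPredictor P X S f α p)).toReal|)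
      =O[𝓝[>] 0] (fun ξ : ℝ => ξ) := by
  classical
  obtain ⟨ω₀⟩ : Nonempty Ω := nonempty_of_isProbabilityMeasure P
  have : Nonempty 𝒮 := ⟨S ω₀⟩
  set J := quantileCost P X S f (clippedReal P X S f α α p) with hJ
  have hmeas := fun β s => measurable_clippedReal hX hS hpos hf (α := α) (β := β) (p := p) s
  have hJfin : J ≠ ∞ := quantileCost_clippedReal_ne_top hX hS hpos hf hdens
  have hrisk : ∀ β, excessRisk P X S f (clippedPredictor P X S f α β p) =
      quantileCost P X S f (clippedReal P X S f α β p) := fun β => by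
    rw [clippedPredictor_eq, excessRisk_transportPredictor hX hS hpos hf hdens (hmeas β)]
  have hriskJ : excessRisk P X S f (optPredictor P X S f α p) = J := hrisk α
  have hlaw : ∀ β, condLaw P X S (clippedPredictor P X S f α β p) =
      fun s => unif.map (clippedReal P X S f α β p s) := fun β => by
    funext s
    rw [clippedPredictor_eq, condLaw_transportPredictor hX hS hpos hf hdens (hmeas β)]
  have hbary : ∀ β, α ≤ β → barycenterCost P X S f
      (condLaw P X S (clippedPredictor P X S f α β p)) =
      quantileCost P X S f (clippedReal P X S f α β p) := fun β hβ => by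
    rw [hlaw, barycenterCost_map_unif hX hS hpos hf (hmeas β)
      (monotoneOn_clippedReal hX hS hpos hf hβ)]
  have hfair : ∀ ξ : ℝ, 0 < ξ → xiPredictor P X S f α p ξ ∈ fairClass P X S α p :=
    fun ξ hξ => (isTailCommon_clippedReal_add hX hS hpos hf hξ).transportPredictor_mem_fairClass
      hp hX hS hpos hf hdens (hmeas _)
  have hxi : ∀ ξ : ℝ, 0 < ξ → excessRisk P X S f (xiPredictor P X S f α p ξ) ≤
      ENNReal.ofReal (1 + ξ) * J + ENNReal.ofReal (ξ + ξ ^ 2) := fun ξ hξ => by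
    rw [xiPredictor, hrisk]
    exact quantileCost_clippedReal_add_le hX hS hpos hf hξ
  have hlowM : ∀ ν ∈ measureClass 𝒮 α p, J ≤ barycenterCost P X S f ν := fun ν hν => by
    have := isProbabilityMeasure_of_mem_measureClass hν
    rw [barycenterCost_eq_quantileCost hX hS hpos hf ν]
    exact quantileCost_clippedReal_le hX hS hpos hf (fun _ => measurable_quantileReal)
      (isTailCommon_quantileReal hν hp)
  have hmem : ∀ g ∈ fairClass P X S α p, condLaw P X S g ∈ measureClass 𝒮 α p :=
    fun g hg => condLaw_mem_measureClass hX hS hpos hg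
  have hlow : ∀ g ∈ fairClass P X S α p, J ≤ excessRisk P X S f g := fun g hg =>
    (hlowM _ (hmem g hg)).trans (barycenterCost_le_excessRisk hX hS hf hg.1)
  have hmin : optPredictor P X S f α p ∈ fairClass P X S α p →
      IsFairMinimizer P X S f α p (optPredictor P X S f α p) := fun h =>
    ⟨h, fun g hg => hriskJ.le.trans (hlow g hg)⟩
  have hcond : (∀ t ∈ Set.Ioc p 1, (α : EReal) ≤ avgQuantile P X S f t) →
      optPredictor P X S f α p ∈ fairClass P X S α p := by
    intro h
    refine (isTailCommon_clippedReal hX hS hpos hf fun u hu hup =>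
      lt_max_of_lt_right ?_).transportPredictor_mem_fairClass hp hX hS hpos hf hdens (hmeas _)
    -- The hypothesis is a weak inequality and fairness needs a strict one: it is applied at `v <
    -- u`, and the mean quantile increases strictly from `v` to `u`.
    obtain ⟨v, hpv, hvu⟩ := exists_between hup
    have hv : v ∈ Set.Ioo (0 : ℝ) 1 := ⟨hp.1.trans_lt hpv, hvu.trans hu.2⟩
    have := h v ⟨hpv, hv.2.le⟩
    rw [← coe_meanQuantile hX hS hpos hf hv, EReal.coe_le_coe_iff] at this
    exact this.trans_lt (strictMonoOn_meanQuantile hX hS hpos hf hdens hv hu hvu)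
  have hnec : (∃ g, IsFairMinimizer P X S f α p g) →
      ∀ t ∈ Set.Ioc p 1, (α : EReal) ≤ avgQuantile P X S f t := by
    rintro ⟨g, hg, hgmin⟩
    -- A minimizer does at least as well as every perturbed regressor, hence its risk is at most
    -- `J`.
    have hgJ : excessRisk P X S f g ≤ J := le_of_forall_le_mul_add hJfin fun ξ hξ =>
      (hgmin _ (hfair ξ hξ)).trans (hxi ξ hξ)
    have key : ∀ t ∈ Set.Ioo p 1, α ≤ meanQuantile P X S f t := by
      intro t ht
      by_contra hlt
      have hprob := isProbabilityMeasure_of_mem_measureClass (hmem g hg)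
      have h1 := quantileCost_clippedReal_lt hX hS hpos hf hdens hp.1
        (T := fun s => quantileReal (condLaw P X S g s)) (fun _ => measurable_quantileReal)
        (isTailCommon_quantileReal (hmem g hg) hp) ht (not_le.1 hlt)
      rw [← barycenterCost_eq_quantileCost hX hS hpos hf] at h1
      exact absurd ((barycenterCost_le_excessRisk hX hS hf hg.1).trans hgJ) (not_le.2 h1)
    intro t ht
    -- At `t = 1` the average may be infinite, so the real-valued bound is used at an interior `v <
    -- t` and extended by monotonicity.
    obtain ⟨v, hpv, hvt⟩ := exists_between ht.1
    have hv : v ∈ Set.Ioo (0 : ℝ) 1 := ⟨hp.1.trans_lt hpv, hvt.trans_le ht.2⟩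
    refine le_trans ?_ (avgQuantile_mono hX hS hpos hf hvt.le)
    rw [← coe_meanQuantile hX hS hpos hf hv, EReal.coe_le_coe_iff]
    exact key v ⟨hpv, hv.2⟩
  refine ⟨⟨hriskJ ▸ hJfin, ?_⟩, ?_, fun h => ?_, fun hp1 hcont hlt => ?_, ⟨⟨?_, hcond⟩, hnec, ?_⟩,
    fun ξ hξ => ⟨hfair ξ hξ, ?_⟩, ?_⟩
  · rw [hriskJ]
    refine le_antisymm (le_of_forall_le_mul_add hJfin fun ξ hξ => ?_) (le_iInf₂ hlow)
    exact (iInf₂_le _ (hfair ξ hξ)).trans (hxi ξ hξ)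
  · rw [optPredictor, hbary α le_rfl]
    refine le_antisymm (le_of_forall_le_mul_add hJfin fun ξ hξ => ?_) (le_iInf₂ hlowM)
    refine (iInf₂_le _ (hmem _ (hfair ξ hξ))).trans ?_
    exact (barycenterCost_le_excessRisk hX hS hf (hfair ξ hξ).1).trans (hxi ξ hξ)
  · have := hcond fun t ht => h.trans (avgQuantile_mono hX hS hpos hf ht.1.le)
    exact ⟨hmin this, hmem _ this⟩
  · have hne : (𝓝[Set.Ioc p 1] p).NeBot := by
      rw [nhdsWithin_Ioc_eq_nhdsGT hp1]; infer_instance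
    -- Right continuity carries the strict inequality at `p` to some `t > p`, where the necessary
    -- condition fails.
    obtain ⟨t, ht, htα⟩ := ((hcont.eventually (gt_mem_nhds hlt)).and
      self_mem_nhdsWithin).exists.imp fun t h => And.intro h.2 h.1
    have hno : ¬ ∃ g, IsFairMinimizer P X S f α p g := fun hg =>
      absurd (hnec hg t ht) (not_le.2 htα)
    exact ⟨fun h => hno ⟨_, hmin h⟩, hno⟩
  · exact fun h => hnec ⟨_, hmin h⟩
  · exact fun h => ⟨_, hmin (hcond h)⟩
  · exact ne_top_of_le_ne_top (by finiteness) (hxi ξ hξ)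
  -- The excess over `J` is at most `ξ J + ξ + ξ²`, and `ξ² ≤ ξ` for `ξ < 1`.
  · refine IsBigO.of_bound (J.toReal + 2) ?_
    filter_upwards [Ioo_mem_nhdsGT (zero_lt_one (α := ℝ))] with ξ hξ
    have hup := ENNReal.toReal_mono (by finiteness) (hxi ξ hξ.1)
    rw [ENNReal.toReal_add (by finiteness) (by finiteness), ENNReal.toReal_mul,
      ENNReal.toReal_ofReal (by linarith [hξ.1]),
      ENNReal.toReal_ofReal (by nlinarith [hξ.1])] at hup
    have hfin : excessRisk P X S f (xiPredictor P X S f α p ξ) ≠ ∞ :=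
      ne_top_of_le_ne_top (by finiteness) (hxi ξ hξ.1)
    have hdown := ENNReal.toReal_mono hfin (hlow _ (hfair ξ hξ.1))
    rw [hriskJ, Real.norm_eq_abs, abs_abs, abs_of_nonneg (sub_nonneg.2 hdown), Real.norm_eq_abs,
      abs_of_pos hξ.1]
    nlinarith [hξ.1, hξ.2]
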